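/- Let $A$ be a finite nonempty ground set and $X\subseteq\{0,1\}^{A}$ a nonempty set of feasible decisions. For each $a\in A$ let $z_{a,1},\dots,z_{a,d_a}$ ($d_a\ge 1$) be distinct positive numbers. Let $\mathcal Q$ be the set of all probability distributions $\mathbb Q$ of a random cost vector $\mathbf c=(c_a)_{a\in A}$ with $c_a\in\{z_{a,1},\dots,z_{a,d_a}\}$ for every $a$ (zero probabilities are allowed), let $\mathbf Q=(\mathbb Q_a)_{a\in A}$ be the vector of its marginals, $q_{a,i}=\mathbb Q\{c_a=z_{a,i}\}$, and let $f(\mathbf x,\mathbb Q)=\mathbb E_{\mathbb Q}\{\mathbf c^\top\mathbf x\}$. For sample sizes $\mathbf T=(T_a)_{a\in A}\in\mathbb Z_{>0}^{A}$ put $T_{\min}=\min_{a\in A}T_a$. When the data-generating distribution is $\mathbb Q\in\mathcal Q$, the data consist, for each $a\in A$, of $T_a$ independent observations with law $\mathbb Q_a$; the dependence between observations of different actions is arbitrary but fixed for each $\mathbb Q$ and $\mathbf T$. Let $\widehat{\mathbf Q}_{\mathbf T}=(\widehat{\mathbb Q}_{a,T_a})_{a\in A}$ be the vector of empirical marginal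 distributions. A prediction rule $\hat f$ assigns to all sample sizes $\mathbf T$ a function $\hat f_{\mathbf T}:X\times\prod_{a\in A}\mathcal Q_a\to\mathbb R$, where $\mathcal Q_a$ is the set of probability distributions on $\{z_{a,1},\dots,z_{a,d_a}\}$ (rules that do not depend on $\mathbf T$ are included). For $r>0$ it is called feasible if $$\limsup_{T_{\min}\to\infty}\frac1{T_{\min}}\ln\Pr\bigl\{f(\mathbf x,\mathbb Q)>\hat f_{\mathbf T}(\mathbf x,\widehat{\mathbf Q}_{\mathbf T})\bigr\}\le -r\qquad\forall\,\mathbf x\in X,\ \forall\,\mathbb Q\in\mathcal Q,$$ where the upper limit is over all vectors $\mathbf T$ with $T_{\min}\to\infty$, and $\ln 0=-\infty$. Let $D_{KL}(\mathbb P\,\Vert\,\mathbb Q)=\sum_i p_i\ln(p_i/q_i)$ be the relative entropy, with the conventions $0\ln(0/q)=0$ for $q\ge0$ and $p\ln(p/0)=\infty$ for $p>0$. Put $$r_a=\frac1{T_a}\bigl(\ln|A|+d_a\ln(T_a+1)+T_{\min}\,r\bigr),\qquad a\in A,$$ and define the distributionally robust predictor by $$\hat f_{\mathbf r}(\mathbf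 x,\mathbf P)=\max\bigl\{\mathbb E_{\mathbb Q}\{\mathbf c^\top\mathbf x\}:\ \mathbb Q\in\mathcal Q,\ D_{KL}(\mathbb P_a\,\Vert\,\mathbb Q_a)\le r_a\ \ \forall a\in A\bigr\}$$ for $\mathbf x\in X$ and $\mathbf P=(\mathbb P_a)_{a\in A}\in\prod_{a\in A}\mathcal Q_a$. Theorem. For every $r>0$ the rule $\hat f_{\mathbf r}$ is weakly optimal: it is feasible, and there is no feasible prediction rule $\hat f$ such that $\hat f_{\mathbf T}(\mathbf x,\mathbf Q)<\hat f_{\mathbf r}(\mathbf x,\mathbf Q)$ for all $\mathbf T$, all $\mathbf x\in X$ and all $\mathbb Q\in\mathcal Q$. In particular, no feasible prediction rule satisfies $\hat f_{\mathbf T}\le\hat f_{\mathbf r}-\varepsilon$ everywhere for some $\varepsilon>0$. -/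

import Mathlib

open Filter MeasureTheory

noncomputable section

/-- A combinatorial optimization problem with random costs over a finite ground set `A`: the cost
`c_a` takes values in the finite set `{z_{a,1}, …, z_{a,d_a}}` of positive numbers, and `X` is
a nonempty set of binary decision vectors. -/
structure CostProblem (A : Type*) where
  /-- the number of possible values of the cost of each action -/
  d : A → ℕ
  d_pos : ∀ a, 0 < d a
  /-- the possible values of the cost of each action -/
  z : ∀ a, Fin (d a) → ℝ
  z_pos : ∀ a i, 0 < z a i
  z_injective : ∀ a, Function.Injective (z a)
  /-- the feasible decisions -/
  X : Set (A → ℝ)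
  X_nonempty : X.Nonempty
  X_binary : ∀ x ∈ X, ∀ a, x a = 0 ∨ x a = 1

/-- The minimal sample size. -/
def minSize {A : Type*} (T : A → ℕ+) : ℕ := ⨅ a, (T a : ℕ)

/-- The relative entropy `∑ i, p_i ln (p_i / q_i)`, with `0 ln (0 / q) = 0` for all `q`, and
`p ln (p / 0) = ∞` for `p > 0`. -/
def relEntropy {n : ℕ} (p q : PMF (Fin n)) : EReal :=
  ∑ i, if p i = 0 then 0 else if q i = 0 then ⊤ else
    (((p i).toReal * Real.log ((p i).toReal / (q i).toReal) : ℝ) : EReal)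

namespace CostProblem

variable {A : Type*} (P : CostProblem A)

/-- The candidate joint distributions of the cost vector. A distribution under which every `c_a`
lies in `{z_{a,1}, …, z_{a,d_a}}` is the same as a distribution of the vector of indices `i_a`
with `c_a = z_{a,i_a}`; zero probabilities are allowed. -/
abbrev JointDist : Type _ := PMF (∀ a, Fin (P.d a))

/-- Vectors `(ℚ_1, …, ℚ_m)` of marginal distributions. -/
abbrev Marginals : Type _ := ∀ a, PMF (Fin (P.d a))

variable {P} in
/-- The vector of marginal distributions of a joint distribution. -/
def JointDist.marginals (Q : P.JointDist) : P.Marginals := fun a => Q.map fun i => i a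

/-- A data set with sample sizes `T`: for every action `a`, a vector of `T a` observed costs
(recorded by their indices). -/
abbrev Data (T : A → ℕ+) : Type _ := ∀ a, Fin (T a : ℕ) → Fin (P.d a)

variable {P} in
/-- The vector of empirical marginal distributions of a data set: `q̂_{a,i}` is the fraction of
the `T a` observations of action `a` that equal `z_{a,i}`. -/
def empirical {T : A → ℕ+} (C : P.Data T) : P.Marginals := fun a =>
  (PMF.uniformOfFintype (Fin (T a : ℕ))).map (C a)

/-- How data sets are generated, for every data-generating distribution `Q` and all sample sizes
`T`: for each action `a` the `T a` observations are independent with the common law `Q_a`.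
Nothing is required of the dependence between observations of different actions. -/
structure DataLaw where
  /-- the law of the data set -/
  law : ∀ (_ : P.JointDist) (T : A → ℕ+), PMF (P.Data T)
  iid : ∀ (Q : P.JointDist) (T : A → ℕ+) (a : A) (v : Fin (T a : ℕ) → Fin (P.d a)),
    (law Q T).map (fun C => C a) v = ∏ j, Q.marginals a (v j)

/-- Prediction rules: a prediction of the expected loss from a decision and a vector of marginal
distributions. The rule may depend on the sample sizes `T`, as the robust one below does through
its radii; a rule that ignores them is a constant function of `T`. -/
abbrev PredictionRule : Type _ := (A → ℕ+) → P.X → P.Marginals → ℝ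

variable [Fintype A]

/-- The expected loss `f(x, Q) = E_Q[cᵀ x]`. -/
def expectedLoss (x : A → ℝ) (Q : P.JointDist) : ℝ :=
  ∫ i, ∑ a, P.z a (i a) * x a ∂Q.toMeasure

/-- The out-of-sample disappointment `Pr {f(x, Q) > f̂(x, Q̂_T)}`. -/
def disappointment (L : P.DataLaw) (f : P.PredictionRule) (x : P.X) (Q : P.JointDist)
    (T : A → ℕ+) : ENNReal :=
  (L.law Q T).toMeasure {C | f T x (empirical C) < P.expectedLoss x Q}

/-- The asymptotic guarantee with rate `r`: for all decisions and all data-generating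
distributions, `limsup (1 / T_min) ln (disappointment) ≤ - r` as `T_min → ∞`, where `T` ranges over
all vectors of sample sizes and `ln 0 = -∞`. -/
def IsFeasible (L : P.DataLaw) (r : ℝ) (f : P.PredictionRule) : Prop :=
  ∀ (x : P.X) (Q : P.JointDist),
    limsup (fun T : A → ℕ+ =>
      ((((minSize T : ℝ)⁻¹ : ℝ)) : EReal) * ENNReal.log (P.disappointment L f x Q T))
      (comap minSize atTop) ≤ ((-r : ℝ) : EReal)

/-- `f` is strictly less conservative than `g` at all decisions and distributions. -/
def LessConservative (f g : P.PredictionRule) : Prop :=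
  ∀ (T : A → ℕ+) (x : P.X) (Q : P.JointDist), f T x Q.marginals < g T x Q.marginals

/-- Weak optimality for the prediction problem with decay rate `r`. As `LessConservative` asks
for a strict inequality only, without a uniform gap, this also excludes every feasible rule that
is smaller by a common `ε > 0`. -/
def IsWeaklyOptimal (L : P.DataLaw) (r : ℝ) (f : P.PredictionRule) : Prop :=
  P.IsFeasible L r f ∧ ¬ ∃ g : P.PredictionRule, P.IsFeasible L r g ∧ P.LessConservative g f

/-- The radii `r_a = (ln |A| + d_a ln (T_a + 1) + T_min r) / T_a`. -/
def radius (r : ℝ) (T : A → ℕ+) (a : A) : ℝ :=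
  (Real.log (Fintype.card A) + P.d a * Real.log ((T a : ℝ) + 1) + minSize T * r) / (T a : ℝ)

/-- The joint distributions whose marginals lie in the relative entropy balls around `p`. -/
def ambiguitySet (ρ : A → ℝ) (p : P.Marginals) : Set P.JointDist :=
  {Q | ∀ a, relEntropy (p a) (Q.marginals a) ≤ (ρ a : EReal)}

/-- The distributionally robust predictor: the worst-case expected loss over the ambiguity set
with the radii `radius r T`. -/
def robustPredictor (r : ℝ) : P.PredictionRule := fun T x p =>
  sSup (P.expectedLoss x '' P.ambiguitySet (P.radius r T) p)

end CostProblem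

end

/-! Feasibility: the robust prediction can fall below the true loss only if the true distribution
leaves the ambiguity set, so some empirical marginal is further than `radius` from its true law.
Sanov's bound by the method of types (`sum_prod_relEntropy_gt_le`) and a union bound over actions
give probability at most `exp (-(minSize T * r))` for every `T`. The union bound makes the
dependence between actions irrelevant. Optimality: under a point mass at the largest costs the data
reveal the marginals exactly and the robust prediction is the true loss. A strictly smaller rule
then disappoints with probability one, so its rate is `0 > -r`. -/

/-! ### Method of types -/

open Finset in
/-- The number of occurrences of each letter in a word of length `n`. -/
def letterCount {n d : ℕ} (v : Fin n → Fin d) (i : Fin d) : ℕ := #{j | v j = i}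

/-- The empirical distribution of a nonempty word. -/
noncomputable def wordDist {d : ℕ} {n : ℕ+} (v : Fin (n : ℕ) → Fin d) : PMF (Fin d) :=
  (PMF.uniformOfFintype (Fin (n : ℕ))).map v

theorem wordDist_apply {d : ℕ} {n : ℕ+} (v : Fin (n : ℕ) → Fin d) (i : Fin d) :
    wordDist v i = (letterCount v i : ENNReal) / (n : ℕ) := by
  classical
  simp only [wordDist, PMF.map_apply, PMF.uniformOfFintype_apply, tsum_fintype, Fintype.card_fin,
    letterCount, ENNReal.div_eq_inv_mul]
  rw [← Finset.sum_filter, Finset.sum_const, nsmul_eq_mul, mul_comm]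
  simp only [eq_comm]

theorem toReal_wordDist {d : ℕ} {n : ℕ+} (v : Fin (n : ℕ) → Fin d) (i : Fin d) :
    (wordDist v i).toReal = (letterCount v i : ℝ) / (n : ℕ) := by
  rw [wordDist_apply, ENNReal.toReal_div, ENNReal.toReal_natCast, ENNReal.toReal_natCast]

theorem wordDist_eq_of_letterCount_eq {d : ℕ} {n : ℕ+} {v w : Fin (n : ℕ) → Fin d}
    (h : letterCount v = letterCount w) : wordDist v = wordDist w := by
  ext i
  rw [wordDist_apply, wordDist_apply, h]

theorem wordDist_letter_ne_zero {d : ℕ} {n : ℕ+} (v : Fin (n : ℕ) → Fin d) (j : Fin (n : ℕ)) :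
    wordDist v (v j) ≠ 0 := by
  rw [← PMF.mem_support_iff, wordDist, PMF.support_map]
  exact ⟨j, PMF.mem_support_uniformOfFintype j, rfl⟩

/-- Grouping positions by letter turns a log-likelihood ratio into `n` times a relative entropy. -/
theorem sum_letters_eq {d : ℕ} {n : ℕ+} (v : Fin (n : ℕ) → Fin d) (h : Fin d → ℝ) :
    ∑ j, h (v j) = (n : ℕ) * ∑ i, (wordDist v i).toReal * h i := by
  classical
  have hn : ((n : ℕ) : ℝ) ≠ 0 := by exact_mod_cast n.ne_zero
  rw [← Finset.sum_fiberwise (s := Finset.univ) (g := v), Finset.mul_sum]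
  refine Finset.sum_congr rfl fun i _ => ?_
  rw [toReal_wordDist, Finset.sum_congr rfl (g := fun _ => h i), Finset.sum_const, nsmul_eq_mul,
    letterCount]
  · field_simp
  · intro j hj
    rw [(Finset.mem_filter.1 hj).2]

theorem ereal_coe_sum {ι : Type*} (s : Finset ι) (f : ι → ℝ) :
    ((∑ i ∈ s, f i : ℝ) : EReal) = ∑ i ∈ s, (f i : EReal) :=
  map_sum (⟨⟨Real.toEReal, EReal.coe_zero⟩, EReal.coe_add⟩ : ℝ →+ EReal) f s

/-- A word whose empirical distribution has relative entropy more than `ρ` with respect to `q` is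
`exp (n ρ)` times less likely under `q` than under its own empirical distribution. -/
theorem prod_le_exp_mul_prod_wordDist {d : ℕ} {n : ℕ+} (q : PMF (Fin d)) (ρ : ℝ)
    (v : Fin (n : ℕ) → Fin d) (hv : (ρ : EReal) < relEntropy (wordDist v) q) :
    ∏ j, q (v j) ≤ ENNReal.ofReal (Real.exp (-((n : ℕ) * ρ))) * ∏ j, wordDist v (v j) := by
  by_cases h0 : ∃ j, q (v j) = 0
  · obtain ⟨j, hj⟩ := h0
    rw [Finset.prod_eq_zero (Finset.mem_univ j) hj]
    exact zero_le
  push Not at h0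
  -- Every letter of `v` is now charged by `q`, so the relative entropy is finite and `hv` becomes a
  -- real inequality.
  have hq : ∀ i, wordDist v i ≠ 0 → q i ≠ 0 := by
    intro i hi
    rw [← PMF.mem_support_iff, wordDist, PMF.support_map] at hi
    obtain ⟨j, -, rfl⟩ := hi
    exact h0 j
  have hD : relEntropy (wordDist v) q =
      ((∑ i, (wordDist v i).toReal * Real.log ((wordDist v i).toReal / (q i).toReal) : ℝ) :
        EReal) := by
    rw [relEntropy, ereal_coe_sum]
    refine Finset.sum_congr rfl fun i _ => ?_
    by_cases hi : wordDist v i = 0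
    · simp [hi]
    · rw [if_neg hi, if_neg (hq i hi)]
  rw [hD, EReal.coe_lt_coe_iff] at hv
  have hp_pos : ∀ j, 0 < (wordDist v (v j)).toReal := fun j =>
    ENNReal.toReal_pos (wordDist_letter_ne_zero v j) (PMF.apply_ne_top _ _)
  have hq_pos : ∀ j, 0 < (q (v j)).toReal := fun j =>
    ENNReal.toReal_pos (h0 j) (PMF.apply_ne_top _ _)
  have hn : (0 : ℝ) < (n : ℕ) := by exact_mod_cast n.pos
  have hprod : Real.exp ((n : ℕ) * ρ) * ∏ j, (q (v j)).toReal ≤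
      ∏ j, (wordDist v (v j)).toReal := by
    rw [← le_div_iff₀ (Finset.prod_pos fun j _ => hq_pos j), ← Finset.prod_div_distrib,
      ← Real.exp_log (Finset.prod_pos fun j _ => div_pos (hp_pos j) (hq_pos j)),
      Real.log_prod fun j _ => (div_pos (hp_pos j) (hq_pos j)).ne',
      sum_letters_eq v fun i => Real.log ((wordDist v i).toReal / (q i).toReal)]
    gcongr
  rw [← ENNReal.toReal_le_toReal (ENNReal.prod_ne_top fun j _ => PMF.apply_ne_top _ _)
    (ENNReal.mul_ne_top ENNReal.ofReal_ne_top (ENNReal.prod_ne_top fun j _ =>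
      PMF.apply_ne_top _ _)), ENNReal.toReal_mul, ENNReal.toReal_ofReal (Real.exp_pos _).le,
    ENNReal.toReal_prod, ENNReal.toReal_prod, Real.exp_neg, inv_mul_eq_div,
    le_div_iff₀ (Real.exp_pos _), mul_comm]
  exact hprod

theorem sum_prod_pmf {d n : ℕ} (q : PMF (Fin d)) : ∑ v : Fin n → Fin d, ∏ j, q (v j) = 1 := by
  have h : ∑ i, q i = 1 := (tsum_fintype _).symm.trans q.tsum_coe
  rw [← Fintype.piFinset_univ, ← Finset.prod_univ_sum]
  simp [h]

/-- There are at most `(n + 1) ^ d` types of words of length `n`, and the likelihoods of the words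
of one type under their empirical distribution sum to at most one. -/
theorem sum_prod_wordDist_le {d : ℕ} (n : ℕ+) :
    ∑ v : Fin (n : ℕ) → Fin d, ∏ j, wordDist v (v j) ≤ (((n : ℕ) + 1) ^ d : ℕ) := by
  classical
  let count (v : Fin (n : ℕ) → Fin d) (i : Fin d) : Fin ((n : ℕ) + 1) :=
    ⟨letterCount v i, Nat.lt_succ_of_le ((Finset.card_le_univ _).trans_eq (Fintype.card_fin _))⟩
  rw [← Finset.sum_fiberwise (s := Finset.univ) (g := count)]
  refine (Finset.sum_le_card_nsmul _ _ 1 fun c _ => ?_).trans_eq (by simp)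
  -- All words of a nonempty class share the empirical distribution of `w`, so their sum is part of
  -- the total mass of one product law.
  rcases Finset.eq_empty_or_nonempty (Finset.univ.filter fun v => count v = c) with h | ⟨w, hw⟩
  · simp [h]
  · calc ∑ v with count v = c, ∏ j, wordDist v (v j)
        = ∑ v with count v = c, ∏ j, wordDist w (v j) := by
          refine Finset.sum_congr rfl fun v hv => ?_
          have hvw : count v = count w :=
            (Finset.mem_filter.1 hv).2.trans (Finset.mem_filter.1 hw).2.symm
          rw [wordDist_eq_of_letterCount_eq (w := w)]
          funext i
          exact congrArg Fin.val (congrFun hvw i)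
      _ ≤ ∑ v : Fin (n : ℕ) → Fin d, ∏ j, wordDist w (v j) :=
          Finset.sum_le_sum_of_subset (Finset.filter_subset _ _)
      _ = 1 := sum_prod_pmf _

open scoped Classical in
/-- Sanov's upper bound for the complement of a relative entropy ball. -/
theorem sum_prod_relEntropy_gt_le {d : ℕ} (n : ℕ+) (q : PMF (Fin d)) (ρ : ℝ) :
    ∑ v : Fin (n : ℕ) → Fin d with (ρ : EReal) < relEntropy (wordDist v) q, ∏ j, q (v j) ≤
      ENNReal.ofReal (((n : ℝ) + 1) ^ d * Real.exp (-((n : ℝ) * ρ))) := by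
  calc _ ≤ ∑ v : Fin (n : ℕ) → Fin d with (ρ : EReal) < relEntropy (wordDist v) q,
        ENNReal.ofReal (Real.exp (-((n : ℕ) * ρ))) * ∏ j, wordDist v (v j) :=
        Finset.sum_le_sum fun v hv =>
          prod_le_exp_mul_prod_wordDist q ρ v (Finset.mem_filter.1 hv).2
    _ ≤ ∑ v : Fin (n : ℕ) → Fin d,
        ENNReal.ofReal (Real.exp (-((n : ℕ) * ρ))) * ∏ j, wordDist v (v j) :=
        Finset.sum_le_sum_of_subset (Finset.filter_subset _ _)
    _ ≤ ENNReal.ofReal (Real.exp (-((n : ℕ) * ρ))) * (((n : ℕ) + 1) ^ d : ℕ) := by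
        rw [← Finset.mul_sum]
        gcongr
        exact sum_prod_wordDist_le n
    _ = _ := by
        rw [mul_comm, ENNReal.ofReal_mul (by positivity), ← ENNReal.ofReal_natCast]
        push_cast
        rfl

theorem relEntropy_self {d : ℕ} (p : PMF (Fin d)) : relEntropy p p = 0 := by
  refine Finset.sum_eq_zero fun i _ => ?_
  by_cases hi : p i = 0
  · simp [hi]
  · have : (p i).toReal ≠ 0 := (ENNReal.toReal_pos hi (PMF.apply_ne_top _ _)).ne'
    rw [if_neg hi, if_neg hi, div_self this, Real.log_one, mul_zero, EReal.coe_zero]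

/-- Constant vectors realize every positive minimum. Along a trivial filter the `limsup` would be
`⊥` and feasibility vacuous. -/
theorem comap_minSize_atTop_neBot {A : Type*} [Nonempty A] :
    (comap (minSize (A := A)) atTop).NeBot := by
  refine comap_neBot_iff_frequently.2 (Eventually.frequently ?_)
  filter_upwards [eventually_gt_atTop 0] with n hn
  exact ⟨fun _ => ⟨n, hn⟩, by simp [minSize]⟩

theorem minSize_pos {A : Type*} [Finite A] [Nonempty A] (T : A → ℕ+) : 0 < minSize T := by
  obtain ⟨a, ha⟩ := exists_eq_ciInf_of_finite (f := fun a => (T a : ℕ))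
  rw [minSize, ← ha]
  exact (T a).pos

/-! ### Data laws, expected losses and the finite-sample guarantee -/

namespace CostProblem

variable {A : Type*} {P : CostProblem A}

/-- Almost surely, the empirical marginals of data generated by a point mass are its marginals. -/
theorem empirical_of_law_pure_ne_zero (L : P.DataLaw) (i : ∀ a, Fin (P.d a)) {T : A → ℕ+}
    {C : P.Data T} (hC : L.law (PMF.pure i) T C ≠ 0) :
    empirical C = JointDist.marginals (P := P) (PMF.pure i) := by
  have hCa : ∀ a, C a = fun _ => i a := by
    intro a
    have h : (L.law (PMF.pure i) T).map (fun C => C a) (C a) ≠ 0 := by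
      rw [← PMF.mem_support_iff, PMF.support_map]
      exact ⟨C, hC, rfl⟩
    rw [L.iid, Finset.prod_ne_zero_iff] at h
    funext j
    by_contra hj
    refine h j (Finset.mem_univ j) ?_
    rw [JointDist.marginals, PMF.pure_map, PMF.pure_apply, if_neg hj]
  funext a
  rw [empirical, JointDist.marginals, PMF.pure_map, hCa a]
  exact PMF.map_const _ _

/-- The probability that the empirical distribution of the observations of `a` is further than
`ρ` from the true one. -/
theorem law_relEntropy_gt_le (L : P.DataLaw) (Q : P.JointDist) (T : A → ℕ+) (a : A) (ρ : ℝ) :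
    (L.law Q T).toMeasure {C | (ρ : EReal) < relEntropy (empirical C a) (Q.marginals a)} ≤
      ENNReal.ofReal (((T a : ℝ) + 1) ^ P.d a * Real.exp (-((T a : ℝ) * ρ))) := by
  classical
  let S : Finset (Fin (T a : ℕ) → Fin (P.d a)) :=
    Finset.univ.filter fun v => (ρ : EReal) < relEntropy (wordDist v) (Q.marginals a)
  have hset : {C : P.Data T | (ρ : EReal) < relEntropy (empirical C a) (Q.marginals a)} =
      (fun C : P.Data T => C a) ⁻¹' (S : Set (Fin (T a : ℕ) → Fin (P.d a))) := by
    ext C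
    rw [Set.mem_preimage, Finset.mem_coe, Finset.mem_filter_univ]
    rfl
  rw [hset, ← PMF.toMeasure_map_apply _ _ _ (measurable_pi_apply a) S.measurableSet,
    PMF.toMeasure_apply_finset]
  simp_rw [L.iid]
  exact sum_prod_relEntropy_gt_le (T a) (Q.marginals a) ρ

variable [Fintype A]

/-- Needed because a real `sSup` bounds its members only when the set is bounded above. -/
theorem bddAbove_range_expectedLoss (x : A → ℝ) : BddAbove (Set.range (P.expectedLoss x)) := by
  obtain ⟨M, hM⟩ := (Set.finite_range fun i : ∀ a, Fin (P.d a) =>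
    ‖∑ a, P.z a (i a) * x a‖).bddAbove
  refine ⟨M, ?_⟩
  rintro _ ⟨Q, rfl⟩
  refine (Real.le_norm_self _).trans ((norm_integral_le_of_norm_le_const (C := M)
    (Eventually.of_forall fun i => hM ⟨i, rfl⟩)).trans_eq ?_)
  simp

theorem expectedLoss_le_of_forall_le {x : A → ℝ} {M : ℝ}
    (h : ∀ i : ∀ a, Fin (P.d a), ∑ a, P.z a (i a) * x a ≤ M) (Q : P.JointDist) :
    P.expectedLoss x Q ≤ M := by
  calc P.expectedLoss x Q ≤ ∫ _, M ∂Q.toMeasure :=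
        integral_mono (Integrable.of_finite) (integrable_const M) h
    _ = M := by simp

theorem expectedLoss_pure (x : A → ℝ) (i : ∀ a, Fin (P.d a)) :
    P.expectedLoss x (PMF.pure i) = ∑ a, P.z a (i a) * x a := by
  rw [expectedLoss, PMF.toMeasure_pure, integral_dirac]

theorem radius_nonneg [Nonempty A] {r : ℝ} (hr : 0 ≤ r) (T : A → ℕ+) (a : A) :
    0 ≤ P.radius r T a := by
  have h1 : 0 ≤ Real.log (Fintype.card A) := Real.log_natCast_nonneg _
  have h2 : 0 ≤ Real.log ((T a : ℝ) + 1) := Real.log_nonneg (by simp)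
  unfold radius
  positivity

/-- This dictates the radius: `ln |A|` pays for the union bound and `d_a ln (T_a + 1)` for the
number of types. -/
theorem pow_mul_exp_radius [Nonempty A] (r : ℝ) (T : A → ℕ+) (a : A) :
    ((T a : ℝ) + 1) ^ P.d a * Real.exp (-((T a : ℝ) * P.radius r T a)) =
      (Fintype.card A : ℝ)⁻¹ * Real.exp (-(minSize T * r)) := by
  have hT : ((T a : ℕ) : ℝ) ≠ 0 := by exact_mod_cast (T a).ne_zero
  have hA : (0 : ℝ) < Fintype.card A := by exact_mod_cast Fintype.card_pos
  have hT1 : (0 : ℝ) < (T a : ℝ) + 1 := by positivity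
  rw [radius, mul_div_cancel₀ _ hT, neg_add, neg_add, Real.exp_add, Real.exp_add,
    Real.exp_neg (Real.log _), Real.exp_log hA, Real.exp_neg (_ * Real.log _), Real.exp_nat_mul,
    Real.exp_log hT1]
  field_simp

/-- The finite-sample guarantee of the robust predictor. -/
theorem disappointment_robustPredictor_le [Nonempty A] (L : P.DataLaw) (r : ℝ) (x : P.X)
    (Q : P.JointDist) (T : A → ℕ+) :
    P.disappointment L (P.robustPredictor r) x Q T ≤
      ENNReal.ofReal (Real.exp (-(minSize T * r))) := by
  have hsub : {C | P.robustPredictor r T x (empirical C) < P.expectedLoss x Q} ⊆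
      ⋃ a, {C : P.Data T |
        (P.radius r T a : EReal) < relEntropy (empirical C a) (Q.marginals a)} := by
    intro C hC
    by_contra hmem
    simp only [Set.mem_iUnion, Set.mem_ofPred_eq, not_exists, not_lt] at hmem
    have hQ : Q ∈ P.ambiguitySet (P.radius r T) (empirical C) := hmem
    have hle : P.expectedLoss x Q ≤ P.robustPredictor r T x (empirical C) :=
      le_csSup ((bddAbove_range_expectedLoss _).mono (Set.image_subset_range _ _))
        (Set.mem_image_of_mem _ hQ)
    exact hle.not_gt hC
  have hA : (Fintype.card A : ℝ) ≠ 0 := by exact_mod_cast Fintype.card_ne_zero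
  calc P.disappointment L (P.robustPredictor r) x Q T
      ≤ ∑ a, (L.law Q T).toMeasure {C : P.Data T |
          (P.radius r T a : EReal) < relEntropy (empirical C a) (Q.marginals a)} :=
        (measure_mono hsub).trans (measure_iUnion_fintype_le _ _)
    _ ≤ ∑ _a : A, ENNReal.ofReal ((Fintype.card A : ℝ)⁻¹ * Real.exp (-(minSize T * r))) := by
        refine Finset.sum_le_sum fun a _ => (law_relEntropy_gt_le L Q T a _).trans_eq ?_
        rw [pow_mul_exp_radius]
    _ = ENNReal.ofReal (Real.exp (-(minSize T * r))) := by
        rw [← ENNReal.ofReal_sum_of_nonneg fun _ _ => by positivity, Finset.sum_const,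
          nsmul_eq_mul, Finset.card_univ, mul_inv_cancel_left₀ hA]

theorem isFeasible_robustPredictor [Nonempty A] (L : P.DataLaw) (r : ℝ) :
    P.IsFeasible L r (P.robustPredictor r) := by
  intro x Q
  refine limsup_le_of_le (h := Eventually.of_forall fun T => ?_)
  have hT : (0 : ℝ) < minSize T := by exact_mod_cast minSize_pos T
  calc ((((minSize T : ℝ)⁻¹ : ℝ)) : EReal) *
        ENNReal.log (P.disappointment L (P.robustPredictor r) x Q T)
      ≤ (((minSize T : ℝ)⁻¹ : ℝ) : EReal) * ((-(minSize T * r) : ℝ) : EReal) := by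
        refine mul_le_mul_of_nonneg_left ?_ (by exact_mod_cast (inv_pos.2 hT).le)
        refine (ENNReal.log_monotone (disappointment_robustPredictor_le L r x Q T)).trans_eq ?_
        rw [ENNReal.log_ofReal_of_pos (Real.exp_pos _), Real.log_exp]
    _ = ((-r : ℝ) : EReal) := by
        rw [← EReal.coe_mul]
        congr 1
        field_simp

/-! ### Optimality -/

/-- A rule that lies strictly below the robust predictor underestimates the loss of the point mass
at the largest costs with probability one, whatever the sample sizes. -/
theorem exists_disappointment_eq_one [Nonempty A] (L : P.DataLaw) {r : ℝ} (hr : 0 ≤ r)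
    {g : P.PredictionRule} (hg : P.LessConservative g (P.robustPredictor r)) (x : P.X) :
    ∃ Q : P.JointDist, ∀ T, P.disappointment L g x Q T = 1 := by
  have hmax : ∀ a, ∃ i, ∀ j, P.z a j ≤ P.z a i := fun a =>
    haveI : Nonempty (Fin (P.d a)) := ⟨⟨0, P.d_pos a⟩⟩
    Finite.exists_max (P.z a)
  choose i hi using hmax
  have hx : ∀ a, 0 ≤ x.1 a := fun a => by
    rcases P.X_binary x.1 x.2 a with h | h <;> simp [h]
  let Q : P.JointDist := PMF.pure i
  have hle : ∀ Q' : P.JointDist, P.expectedLoss x Q' ≤ P.expectedLoss x Q := fun Q' => by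
    rw [expectedLoss_pure]
    exact expectedLoss_le_of_forall_le (fun k => Finset.sum_le_sum fun a _ =>
      mul_le_mul_of_nonneg_right (hi a (k a)) (hx a)) Q'
  refine ⟨Q, fun T => ?_⟩
  have hlt : g T x Q.marginals < P.expectedLoss x Q := by
    -- `Q` lies in the ambiguity set around its own marginals and maximizes the loss there, since
    -- `x` is nonnegative.
    refine (hg T x Q).trans_le (csSup_le ⟨_, Q, fun a => ?_, rfl⟩ ?_)
    · rw [relEntropy_self]
      exact_mod_cast radius_nonneg hr T a
    · rintro _ ⟨Q', -, rfl⟩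
      exact hle Q'
  rw [disappointment, PMF.toMeasure_apply_eq_one_iff _ (Set.toFinite _).measurableSet]
  intro C hC
  rw [Set.mem_ofPred_eq, empirical_of_law_pure_ne_zero L i hC]
  exact hlt

theorem not_isFeasible_of_lessConservative [Nonempty A] (L : P.DataLaw) {r : ℝ} (hr : 0 < r)
    {g : P.PredictionRule} (hg : P.LessConservative g (P.robustPredictor r)) :
    ¬ P.IsFeasible L r g := by
  intro hfeas
  obtain ⟨x, hx⟩ := P.X_nonempty
  obtain ⟨Q, hQ⟩ := exists_disappointment_eq_one L hr.le hg ⟨x, hx⟩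
  have h := hfeas ⟨x, hx⟩ Q
  have := comap_minSize_atTop_neBot (A := A)
  -- The sequence is constantly zero because `ln 1 = 0`, so feasibility would force `0 ≤ -r`.
  simp only [hQ, ENNReal.log_one, mul_zero, limsup_const] at h
  have h' : (0 : ℝ) ≤ -r := by exact_mod_cast h
  linarith

end CostProblem

theorem theorem2 {A : Type*} [Fintype A] [Nonempty A] (P : CostProblem A) (L : P.DataLaw)
    (r : ℝ) (hr : 0 < r) :
    P.IsWeaklyOptimal L r (P.robustPredictor r) :=
  ⟨CostProblem.isFeasible_robustPredictor L r, fun ⟨_, hfeas, hless⟩ =>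
    CostProblem.not_isFeasible_of_lessConservative L hr hless hfeas⟩
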